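/- For a list $\sigma=(\lambda_1,\dots,\lambda_5)$ of real numbers let $e_k(\sigma)$ be the $k$-th elementary symmetric function of $\lambda_1,\dots,\lambda_5$ (so $e_1(\sigma)=\sum_i\lambda_i$), and let $r(\sigma)=e_3(\sigma)+e_1(\sigma)(\lambda_2^2+\lambda_5^2)$. Call $\sigma$ realizable by a $5\times5$ nonnegative matrix if there is a real $5\times 5$ matrix with all entries $\ge 0$ whose eigenvalues, counted with algebraic multiplicity, are $\lambda_1,\dots,\lambda_5$. (a) If $e_1(\sigma)\ge 0$, $\lambda_3>e_1(\sigma)$ and $\lambda_1\ge\lambda_2\ge\lambda_3\ge\lambda_4\ge\lambda_5=-\lambda_1$, then $\sigma$ is not realizable by a $5\times5$ nonnegative matrix. (b) The conditions $e_1(\sigma)\ge 0$, $\lambda_3>e_1(\sigma)$, $\lambda_1\ge\lambda_2\ge\lambda_3\ge\lambda_4\ge\lambda_5>-\lambda_1$ and $r(\sigma)\ge 0$ together are known to imply that $\sigma$ is realizable by a symmetric $5\times5$ nonnegative matrix. Here the condition $\lambda_5>-\lambda_1$ cannot be dropped: there is a real list $\sigma$ with $e_1(\sigma)\ge 0$,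 $\lambda_3>e_1(\sigma)$, $\lambda_1\ge\lambda_2\ge\lambda_3\ge\lambda_4\ge\lambda_5$ and $r(\sigma)\ge 0$ that is not realizable by any $5\times5$ nonnegative matrix, symmetric or not. (The background implication recalled in the first sentence of (b) is not part of the claim.) -/

import Mathlib

/-- The `k`-th elementary symmetric function of the entries of a list `σ` of `n` reals. -/
def elemSymm {n : ℕ} (σ : Fin n → ℝ) (k : ℕ) : ℝ :=
  ∑ s ∈ Finset.powersetCard k (Finset.univ : Finset (Fin n)), ∏ i ∈ s, σ i

/-- `r(σ) = e₃(σ) + e₁(σ) (λ₂² + λ₅²)`, where `λ₁, …, λ₅` are `σ 0, …, σ 4`. -/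
def rFun (σ : Fin 5 → ℝ) : ℝ :=
  elemSymm σ 3 + elemSymm σ 1 * (σ 1 ^ 2 + σ 4 ^ 2)

/-- The list `σ` is the spectrum of `A`: the eigenvalues of `A`, counted with algebraic
multiplicity, are the entries of `σ` in some order. -/
def HasSpectrum {n : ℕ} (A : Matrix (Fin n) (Fin n) ℝ) (σ : Fin n → ℝ) : Prop :=
  A.charpoly = ∏ i, (Polynomial.X - Polynomial.C (σ i))

/-- The list `σ` of `n` reals is the spectrum of some entrywise nonnegative real `n × n` matrix. -/
def RealizableByNonneg {n : ℕ} (σ : Fin n → ℝ) : Prop :=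
  ∃ A : Matrix (Fin n) (Fin n) ℝ, (∀ i j, 0 ≤ A i j) ∧ HasSpectrum A σ

open Polynomial

/-! A nonnegative `A` has `tr (A ^ k) ≥ 0`, and this trace is the `k`-th power sum of the spectrum;
both parts exhibit a negative odd power sum. In (a), `λ₁` and `λ₅` cancel in odd powers, and `-λ₄ >
λ₂ ≥ λ₃ ≥ 0`, so `λ₄` dominates for large odd `k`. In (b), `k = 3` suffices for an explicit list. -/

theorem prod_sub_eq_neg_one_pow_mul_prod_sub {R : Type*} [CommRing R] {n : ℕ} (a b : Fin n → R) :
    ∏ i, (a i - b i) = (-1) ^ n * ∏ i, (b i - a i) := by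
  calc ∏ i, (a i - b i) = ∏ i, (-1) * (b i - a i) := Finset.prod_congr rfl fun i _ => by ring
    _ = (-1) ^ n * ∏ i, (b i - a i) := by simp only [Finset.prod_mul_distrib]; simp

/-- Spectral mapping for determinants: if the eigenvalues of `A` are `a i`, then
`det (p(A)) = ∏ p(a i)` for every monic split polynomial `p`. -/
theorem det_aeval_of_charpoly_eq_prod {K : Type*} [Field K] {n : ℕ}
    {A : Matrix (Fin n) (Fin n) K} {a : Fin n → K}
    (hA : A.charpoly = ∏ i, (X - C (a i))) {p : K[X]} (hp : p.Splits) (hm : p.Monic) :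
    (aeval A p).det = ∏ i, p.eval (a i) := by
  have key : ∀ s : Multiset K, (aeval A (s.map fun r => X - C r).prod).det
      = ∏ i, ((s.map fun r => X - C r).prod).eval (a i) := by
    intro s
    induction s using Multiset.induction_on with
    | empty => simp
    | cons r s ih =>
      have hr : (aeval A (X - C r)).det = ∏ i, (X - C r).eval (a i) := by
        have h := Matrix.eval_charpoly A r
        rw [hA, eval_prod] at h
        have hneg : aeval A (X - C r) = -(Matrix.scalar (Fin n) r - A) := by
          simp [Matrix.algebraMap_eq_diagonal, Pi.algebraMap_def]
        rw [hneg, Matrix.det_neg, ← h, Fintype.card_fin]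
        simp only [eval_sub, eval_X, eval_C]
        exact (prod_sub_eq_neg_one_pow_mul_prod_sub a fun _ => r).symm
      simp only [Multiset.map_cons, Multiset.prod_cons, map_mul, Matrix.det_mul, eval_mul,
        Finset.prod_mul_distrib, ih, hr]
  rw [hp.eq_prod_roots_of_monic hm]
  exact key _

/-- The eigenvalues of `A ^ k` are the `k`-th powers of the eigenvalues of `A`. -/
theorem charpoly_pow_of_charpoly_eq_prod {K : Type*} [Field K] [IsAlgClosed K] {n : ℕ}
    {A : Matrix (Fin n) (Fin n) K} {a : Fin n → K}
    (hA : A.charpoly = ∏ i, (X - C (a i))) {k : ℕ} (hk : k ≠ 0) :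
    (A ^ k).charpoly = ∏ i, (X - C (a i ^ k)) := by
  have : Infinite K := IsAlgClosed.instInfinite
  refine Polynomial.funext fun z => ?_
  -- Up to sign, `det (A ^ k - z)` is the characteristic polynomial of `A ^ k` at `z`.
  have h := det_aeval_of_charpoly_eq_prod hA (IsAlgClosed.splits (X ^ k - C z))
    (monic_X_pow_sub_C z hk)
  have hneg : aeval A (X ^ k - C z) = -(Matrix.scalar (Fin n) z - A ^ k) := by
    simp [Matrix.algebraMap_eq_diagonal, Pi.algebraMap_def]
  rw [hneg, Matrix.det_neg, Fintype.card_fin, ← Matrix.eval_charpoly] at h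
  have hprod : ∏ i, (X ^ k - C z).eval (a i) = (-1) ^ n * (∏ i, (X - C (a i ^ k))).eval z := by
    simp only [eval_prod, eval_sub, eval_pow, eval_X, eval_C]
    exact prod_sub_eq_neg_one_pow_mul_prod_sub (fun i => a i ^ k) fun _ => z
  rw [hprod] at h
  exact mul_left_cancel₀ (pow_ne_zero n (neg_ne_zero.mpr one_ne_zero)) h

theorem HasSpectrum.trace_pow {n : ℕ} {A : Matrix (Fin n) (Fin n) ℝ} {σ : Fin n → ℝ}
    (h : HasSpectrum A σ) {k : ℕ} (hk : k ≠ 0) : (A ^ k).trace = ∑ i, σ i ^ k := by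
  -- Over `ℂ` every `X ^ k - C z` splits, as spectral mapping requires.
  have hC : (A.map (algebraMap ℝ ℂ)).charpoly = ∏ i, (X - C ((σ i : ℂ))) := by
    rw [Matrix.charpoly_map, h, Polynomial.map_prod]
    simp
  have hp := charpoly_pow_of_charpoly_eq_prod hC hk
  have ht := Matrix.trace_eq_sum_roots_charpoly (A.map (algebraMap ℝ ℂ) ^ k)
  have hpow : A.map (algebraMap ℝ ℂ) ^ k = (A ^ k).map (algebraMap ℝ ℂ) :=
    (map_pow (algebraMap ℝ ℂ).mapMatrix A k).symm
  have hroots : (∏ i, (X - C ((σ i : ℂ) ^ k))).roots = Finset.univ.val.map fun i => (σ i : ℂ) ^ k := by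
    rw [← roots_multiset_prod_X_sub_C (Finset.univ.val.map fun i => (σ i : ℂ) ^ k),
      Multiset.map_map]
    rfl
  rw [hp, hroots, hpow] at ht
  have : (((A ^ k).trace : ℝ) : ℂ) = ((∑ i, σ i ^ k : ℝ) : ℂ) := by
    simpa [Matrix.trace, List.sum_ofFn] using ht
  exact_mod_cast this

theorem Matrix.pow_apply_nonneg_of_nonneg {n : ℕ} {A : Matrix (Fin n) (Fin n) ℝ}
    (hA : ∀ i j, 0 ≤ A i j) (k : ℕ) (i j : Fin n) : 0 ≤ (A ^ k) i j := by
  induction k generalizing i j with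
  | zero => rw [pow_zero, Matrix.one_apply]; split_ifs <;> norm_num
  | succ k ih =>
    rw [pow_succ, Matrix.mul_apply]
    exact Finset.sum_nonneg fun l _ => mul_nonneg (ih i l) (hA l j)

/-- The power sums of the spectrum of a nonnegative matrix are nonnegative. -/
theorem RealizableByNonneg.sum_pow_nonneg {n : ℕ} {σ : Fin n → ℝ} (h : RealizableByNonneg σ)
    {k : ℕ} (hk : k ≠ 0) : 0 ≤ ∑ i, σ i ^ k := by
  obtain ⟨A, hA, hσ⟩ := h
  rw [← hσ.trace_pow hk]
  exact Finset.sum_nonneg fun i _ => Matrix.pow_apply_nonneg_of_nonneg hA k i i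

theorem elemSymm_one {n : ℕ} (σ : Fin n → ℝ) : elemSymm σ 1 = ∑ i, σ i := by
  simp [elemSymm, Finset.powersetCard_one]

theorem exists_odd_pow_add_pow_lt {b c d : ℝ} (hc : 0 ≤ c) (hcb : c ≤ b) (hbd : b < d) :
    ∃ k : ℕ, Odd k ∧ b ^ k + c ^ k < d ^ k := by
  have hb : 0 ≤ b := hc.trans hcb
  have hd : 0 < d := hb.trans_lt hbd
  have hq : 0 ≤ b / d := div_nonneg hb hd.le
  have hq1 : b / d < 1 := (div_lt_one hd).mpr hbd
  obtain ⟨m, hm⟩ := exists_pow_lt_of_lt_one (one_half_pos (α := ℝ)) hq1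
  refine ⟨2 * m + 1, odd_two_mul_add_one m, ?_⟩
  have h1 : (b / d) ^ (2 * m + 1) < 1 / 2 :=
    (pow_le_pow_of_le_one hq hq1.le (by omega)).trans_lt hm
  rw [div_pow, div_lt_iff₀ (by positivity)] at h1
  have h2 : c ^ (2 * m + 1) ≤ b ^ (2 * m + 1) := pow_le_pow_left₀ hc hcb _
  linarith

theorem mainTheorem10 :
    (∀ σ : Fin 5 → ℝ,
      0 ≤ elemSymm σ 1 →
      σ 2 > elemSymm σ 1 →
      (σ 0 ≥ σ 1 ∧ σ 1 ≥ σ 2 ∧ σ 2 ≥ σ 3 ∧ σ 3 ≥ σ 4 ∧ σ 4 = -σ 0) →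
      ¬ RealizableByNonneg σ) ∧
    (∃ σ : Fin 5 → ℝ,
      0 ≤ elemSymm σ 1 ∧
      σ 2 > elemSymm σ 1 ∧
      (σ 0 ≥ σ 1 ∧ σ 1 ≥ σ 2 ∧ σ 2 ≥ σ 3 ∧ σ 3 ≥ σ 4) ∧
      0 ≤ rFun σ ∧
      ¬ RealizableByNonneg σ) := by
  constructor
  · rintro σ h0 h2 ⟨-, h12, -, -, h4⟩ hσ
    rw [elemSymm_one, Fin.sum_univ_five] at h0 h2
    -- Since `σ 0 + σ 4 = 0`, `σ 2 > e₁ = σ 1 + σ 2 + σ 3` gives `σ 1 < -σ 3`.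
    obtain ⟨k, hk, hlt⟩ := exists_odd_pow_add_pow_lt (b := σ 1) (c := σ 2) (d := -σ 3)
      (by linarith) h12 (by linarith)
    have h := hσ.sum_pow_nonneg hk.pos.ne'
    rw [Fin.sum_univ_five, h4, hk.neg_pow] at h
    rw [hk.neg_pow] at hlt
    linarith
  -- Here `λ₅ < -λ₁`; `r = 0.304`, but the sum of cubes is `-1.221`.
  · obtain ⟨σ, h0, h1, h2, h3, h4⟩ : ∃ σ : Fin 5 → ℝ,
        σ 0 = 1 ∧ σ 1 = 1 ∧ σ 2 = 1 ∧ σ 3 = -1 / 2 ∧ σ 4 = -8 / 5 :=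
      ⟨![1, 1, 1, -1 / 2, -8 / 5], rfl, rfl, rfl, rfl, rfl⟩
    have he1 : elemSymm σ 1 = 9 / 10 := by
      rw [elemSymm_one, Fin.sum_univ_five, h0, h1, h2, h3, h4]
      norm_num
    have he3 : elemSymm σ 3 = -29 / 10 := by
      have hs : Finset.powersetCard 3 (Finset.univ : Finset (Fin 5)) =
          {{0, 1, 2}, {0, 1, 3}, {0, 1, 4}, {0, 2, 3}, {0, 2, 4}, {0, 3, 4}, {1, 2, 3},
            {1, 2, 4}, {1, 3, 4}, {2, 3, 4}} := by decide
      rw [elemSymm, hs]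
      repeat rw [Finset.sum_insert (by decide)]
      rw [Finset.sum_singleton]
      repeat rw [Finset.prod_insert (by decide), Finset.prod_insert (by decide),
        Finset.prod_singleton]
      rw [h0, h1, h2, h3, h4]
      norm_num
    refine ⟨σ, ?_, ?_, ?_, ?_, fun hσ => ?_⟩
    · rw [he1]; norm_num
    · rw [he1, h2]; norm_num
    · rw [h0, h1, h2, h3, h4]; norm_num
    · rw [rFun, he1, he3, h1, h4]; norm_num
    · have h := hσ.sum_pow_nonneg (k := 3) (by norm_num)
      rw [Fin.sum_univ_five, h0, h1, h2, h3, h4] at h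
      norm_num at h
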